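/- Let $K$ be a field and let $Q$ be a quiver with finitely many vertices. Let $KQ$ be its path algebra: the $K$-algebra with basis the finite paths of $Q$ (including a path of length zero for each vertex), where the product $pq$ of two paths is the path $p$ followed by $q$ if $q$ starts where $p$ ends, and $0$ otherwise. Let $C$ be the two-sided ideal of $KQ$ generated by all differences $p-q$ of paths $p,q$ that have the same start vertex and the same end vertex, and let $\rho\colon KQ\to KQ/C$ be the canonical surjection. The path connected components $D_1,\dots,D_m$ of $Q$ are the equivalence classes of vertices for the relation $v\sim v'$ if and only if there are a path from $v$ to $v'$ and a path from $v'$ to $v$. For each $j=1,\dots,m$ let $w_j$ be a vertex in $D_j$, and set $$P=\bigoplus_{j=1}^m \rho(w_j)\,KQ/C,$$ a right $KQ/C$-module. Then: 1. $P$ is a projective generator for the category of finitely generated right $KQ/C$-modules, that is, $P$ is finitely generated and projective, and every finitely generated right $KQ/C$-module is a quotient of $P^n$ for some $n\ge 0$. 2. The $K$-algebra $Sk(Q)=\operatorname{End}_{KQ/C}(P)$, called the skeleton of $KQ$, is basic, that is, it is finite dimensional over $K$ and every simple right $Sk(Q)$-module is one-dimensional over $K$. 3. $Sk(Q)$ is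 Morita equivalent to $KQ/C$, that is, the categories of right modules over $Sk(Q)$ and over $KQ/C$ are equivalent as $K$-linear categories. -/

import Mathlib

open scoped DirectSum MulOpposite

/-- The set of all finite paths of a quiver, including the paths of length zero (the vertices);
a path is recorded together with its start vertex and its end vertex. -/
structure QuiverPath (V : Type*) [Quiver V] where
  /-- the vertex where the path starts -/
  src : V
  /-- the vertex where the path ends -/
  tgt : V
  /-- the path itself -/
  path : Quiver.Path src tgt

/-- The path algebra `K Q`: the `K`-vector space with basis the finite paths of the quiver. -/
def PathAlgebra (K : Type*) [Field K] (V : Type*) [Quiver V] : Type _ :=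
  QuiverPath V →₀ K

namespace PathAlgebra

section Basic

variable (K : Type*) [Field K] {V : Type*} [Quiver V]

noncomputable instance : AddCommGroup (PathAlgebra K V) :=
  inferInstanceAs (AddCommGroup (QuiverPath V →₀ K))

noncomputable instance : Module K (PathAlgebra K V) :=
  inferInstanceAs (Module K (QuiverPath V →₀ K))

/-- The basis element of the path algebra given by a path. -/
noncomputable def of (p : QuiverPath V) : PathAlgebra K V :=
  (Finsupp.single p 1 : QuiverPath V →₀ K)

/-- The basis element of the path algebra given by a vertex, that is, by a path of length zero. -/
noncomputable def vertex (v : V) : PathAlgebra K V :=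
  of K ⟨v, v, Quiver.Path.nil⟩

open Classical in
/-- The product of two paths: the path `p` followed by the path `q` if `q` starts where `p` ends,
and zero otherwise. -/
noncomputable def pathMul (p q : QuiverPath V) : PathAlgebra K V :=
  if h : p.tgt = q.src then of K ⟨p.src, q.tgt, p.path.comp (q.path.cast h.symm rfl)⟩ else 0

/-- The bilinear extension of the product of paths. -/
noncomputable def mulHom : PathAlgebra K V →ₗ[K] PathAlgebra K V →ₗ[K] PathAlgebra K V :=
  Finsupp.linearCombination K fun p : QuiverPath V =>
    (Finsupp.linearCombination K (pathMul K p) : PathAlgebra K V →ₗ[K] PathAlgebra K V)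

noncomputable instance : Mul (PathAlgebra K V) := ⟨fun x y => mulHom K x y⟩

theorem mul_def (x y : PathAlgebra K V) : x * y = mulHom K x y := rfl

theorem of_mul_of (p q : QuiverPath V) : of K p * of K q = pathMul K p q := by
  rw [mul_def]
  unfold mulHom of
  erw [Finsupp.linearCombination_single, one_smul, Finsupp.linearCombination_single, one_smul]

theorem comp_of {a b c : V} (p : Quiver.Path a b) (q : Quiver.Path b c) :
    of K ⟨a, b, p⟩ * of K ⟨b, c, q⟩ = of K ⟨a, c, p.comp q⟩ := by
  rw [of_mul_of]
  simp [pathMul]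

theorem of_mul_of_ne (p q : QuiverPath V) (h : p.tgt ≠ q.src) : of K p * of K q = 0 := by
  rw [of_mul_of]
  simp [pathMul, h]

theorem hom_ext {M : Type*} [AddCommGroup M] [Module K M] {f g : PathAlgebra K V →ₗ[K] M}
    (h : ∀ p, f (of K p) = g (of K p)) : f = g :=
  Finsupp.lhom_ext' fun p => LinearMap.ext_ring (h p)

theorem of_mul_assoc (p q r : QuiverPath V) :
    of K p * of K q * of K r = of K p * (of K q * of K r) := by
  obtain ⟨a, b, p⟩ := p
  obtain ⟨b', c, q⟩ := q
  obtain ⟨c', d, r⟩ := r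
  by_cases h : b = b'
  · subst h
    by_cases h' : c = c'
    · subst h'
      simp only [comp_of, Quiver.Path.comp_assoc]
    · rw [comp_of, of_mul_of_ne K _ _ h', of_mul_of_ne K _ _ h', mul_def, map_zero]
  · rw [of_mul_of_ne K ⟨a, b, p⟩ ⟨b', c, q⟩ h]
    by_cases h' : c = c'
    · subst h'
      rw [comp_of, of_mul_of_ne K _ _ h, mul_def, map_zero, LinearMap.zero_apply]
    · rw [of_mul_of_ne K ⟨b', c, q⟩ ⟨c', d, r⟩ h', mul_def, mul_def, map_zero, map_zero,
        LinearMap.zero_apply]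

theorem mul_assoc_aux (x y z : PathAlgebra K V) : x * y * z = x * (y * z) := by
  have key : (LinearMap.llcomp K _ _ _ (mulHom K)).comp (mulHom K (V := V)) =
      ((LinearMap.llcomp K _ _ _).flip (mulHom K)).comp
        ((LinearMap.llcomp K (PathAlgebra K V) _ _).comp (mulHom K)) := by
    refine hom_ext K fun p => hom_ext K fun q => hom_ext K fun r => ?_
    exact of_mul_assoc K p q r
  exact LinearMap.congr_fun (LinearMap.congr_fun (LinearMap.congr_fun key x) y) z

theorem vertex_mul_of (p : QuiverPath V) : vertex K p.src * of K p = of K p := by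
  obtain ⟨a, b, p⟩ := p
  have h := comp_of K (Quiver.Path.nil : Quiver.Path a a) p
  rwa [Quiver.Path.nil_comp] at h

theorem of_mul_vertex (p : QuiverPath V) : of K p * vertex K p.tgt = of K p := by
  obtain ⟨a, b, p⟩ := p
  exact comp_of K p (Quiver.Path.nil : Quiver.Path b b)

end Basic

section Unital

variable (K : Type*) [Field K] {V : Type*} [Quiver V] [Fintype V]

/-- The unit of the path algebra of a quiver with finitely many vertices is the sum of the
vertices. -/
noncomputable instance : One (PathAlgebra K V) := ⟨∑ v : V, vertex K v⟩

theorem one_def : (1 : PathAlgebra K V) = ∑ v : V, vertex K v := rfl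

theorem one_mul_aux (x : PathAlgebra K V) : 1 * x = x := by
  have key : mulHom K (1 : PathAlgebra K V) = LinearMap.id := by
    refine hom_ext K fun p => ?_
    rw [one_def, map_sum, LinearMap.sum_apply, LinearMap.id_apply]
    simp only [← mul_def]
    rw [Finset.sum_eq_single p.src, vertex_mul_of]
    · exact fun v _ hv => of_mul_of_ne K _ _ hv
    · simp
  exact LinearMap.congr_fun key x

theorem mul_one_aux (x : PathAlgebra K V) : x * 1 = x := by
  have key : (mulHom K).flip (1 : PathAlgebra K V) = LinearMap.id := by
    refine hom_ext K fun p => ?_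
    rw [one_def, map_sum, LinearMap.sum_apply, LinearMap.id_apply]
    simp only [LinearMap.flip_apply, ← mul_def]
    rw [Finset.sum_eq_single p.tgt, of_mul_vertex]
    · exact fun v _ hv => of_mul_of_ne K _ _ (Ne.symm hv)
    · simp
  exact LinearMap.congr_fun key x

noncomputable instance : Ring (PathAlgebra K V) :=
  { (inferInstance : AddCommGroup (PathAlgebra K V)),
    (inferInstance : Mul (PathAlgebra K V)),
    (inferInstance : One (PathAlgebra K V)) with
    left_distrib := fun x y z => map_add (mulHom K x) y z
    right_distrib := fun x y z => by simp only [mul_def, map_add, LinearMap.add_apply]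
    zero_mul := fun x => by simp only [mul_def, map_zero, LinearMap.zero_apply]
    mul_zero := fun x => map_zero (mulHom K x)
    mul_assoc := mul_assoc_aux K
    one_mul := one_mul_aux K
    mul_one := mul_one_aux K }

noncomputable instance : Algebra K (PathAlgebra K V) :=
  Algebra.ofModule
    (fun r x y => by simp only [mul_def, map_smul, LinearMap.smul_apply])
    (fun r x y => map_smul (mulHom K x) r y)

end Unital

end PathAlgebra

section CommutingAlgebra

variable (K : Type*) [Field K] (V : Type*) [Quiver V] [Fintype V]

/-- The commuting ideal `C` of `K Q`: the two-sided ideal generated by all differences `p - q` of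
parallel paths, that is, of paths with the same start vertex and the same end vertex. -/
noncomputable def commutingIdeal : TwoSidedIdeal (PathAlgebra K V) :=
  TwoSidedIdeal.span
    {x | ∃ (a b : V) (p q : Quiver.Path a b),
      x = PathAlgebra.of K ⟨a, b, p⟩ - PathAlgebra.of K ⟨a, b, q⟩}

/-- The commuting algebra `K Q / C`. -/
def CommutingAlgebra : Type _ := (commutingIdeal K V).ringCon.Quotient

noncomputable instance : Ring (CommutingAlgebra K V) :=
  inferInstanceAs (Ring (commutingIdeal K V).ringCon.Quotient)

noncomputable instance : Algebra K (CommutingAlgebra K V) :=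
  inferInstanceAs (Algebra K (commutingIdeal K V).ringCon.Quotient)

/-- The canonical surjection `ρ : K Q → K Q / C`. -/
noncomputable def commutingProj : PathAlgebra K V →+* CommutingAlgebra K V :=
  (commutingIdeal K V).ringCon.mk'

variable {V}

/-- The image `ρ(v)` of a vertex `v` under the canonical surjection `ρ : K Q → K Q / C`. -/
noncomputable def vertexClass (v : V) : CommutingAlgebra K V :=
  commutingProj K V (PathAlgebra.vertex K v)

/-- The right ideal `ρ(v) (K Q / C) = {ρ(v) a | a ∈ K Q / C}`. Right modules over a ring `A` are
modules over the opposite ring `Aᵐᵒᵖ`. -/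
noncomputable def vertexRightIdeal (v : V) :
    Submodule (CommutingAlgebra K V)ᵐᵒᵖ (CommutingAlgebra K V) :=
  Submodule.span (CommutingAlgebra K V)ᵐᵒᵖ {vertexClass K v}

/-- The right ideal `ρ(v) (K Q / C)`, viewed as a right `K Q / C`-module. -/
def VertexModule (v : V) : Type _ := vertexRightIdeal K v

noncomputable instance (v : V) : AddCommGroup (VertexModule K v) :=
  inferInstanceAs (AddCommGroup (vertexRightIdeal K v))

noncomputable instance (v : V) : Module (CommutingAlgebra K V)ᵐᵒᵖ (VertexModule K v) :=
  inferInstanceAs (Module (CommutingAlgebra K V)ᵐᵒᵖ (vertexRightIdeal K v))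

noncomputable instance (v : V) : Module K (VertexModule K v) :=
  inferInstanceAs (Module K (vertexRightIdeal K v))

noncomputable instance (v : V) : IsScalarTower K (CommutingAlgebra K V)ᵐᵒᵖ (VertexModule K v) :=
  inferInstanceAs (IsScalarTower K (CommutingAlgebra K V)ᵐᵒᵖ (vertexRightIdeal K v))

/-- The right `K Q / C`-module `P = ⨁ ρ(w_j) (K Q / C)`, where `j` runs through the path connected
components of the quiver: the classes of vertices for the relation "there are a path from `v` to
`v'` and a path from `v'` to `v`". -/
abbrev skeletonModule (w : Quiver.StronglyConnectedComponent V → V) : Type _ :=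
  ⨁ j : Quiver.StronglyConnectedComponent V, VertexModule K (w j)

/-- The skeleton `Sk(Q)`: the `K`-algebra of endomorphisms of the right `K Q / C`-module `P`, with
composition of maps as product. -/
abbrev Skeleton (w : Quiver.StronglyConnectedComponent V → V) : Type _ :=
  Module.End (CommutingAlgebra K V)ᵐᵒᵖ (skeletonModule K w)

end CommutingAlgebra

universe x u v k

/-- `P` is a (finitely generated) projective generator for the category of finitely generated
right modules over `A`: it is finitely generated and projective, and each finitely generated
right `A`-module is a quotient of a finite direct sum of copies of `P`. -/
structure IsRightProjectiveGenerator (A : Type*) [Ring A] (P : Type*) [AddCommGroup P]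
    [Module Aᵐᵒᵖ P] : Prop where
  finite : Module.Finite Aᵐᵒᵖ P
  projective : Module.Projective Aᵐᵒᵖ P
  generates : ∀ (M : Type x) [AddCommGroup M] [Module Aᵐᵒᵖ M], Module.Finite Aᵐᵒᵖ M →
    ∃ (n : ℕ) (f : (Fin n → P) →ₗ[Aᵐᵒᵖ] M), Function.Surjective f

/-- A `K`-algebra is basic if it is finite dimensional and each simple right module over it is
one-dimensional over `K`. -/
structure IsBasicAlgebra (K : Type*) [Field K] (B : Type*) [Ring B] [Algebra K B] : Prop where
  finite : Module.Finite K B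
  simple : ∀ (S : Type x) [AddCommGroup S] [Module K S] [Module Bᵐᵒᵖ S] [IsScalarTower K Bᵐᵒᵖ S],
    IsSimpleModule Bᵐᵒᵖ S → Module.finrank K S = 1

/-! Write `A = KQ/C`. Parallel paths agree in `A`, so `ρ(a) A ρ(b)` is spanned by the class of any
one path from `a` to `b`, and is zero if there is none. If `v` lies in the component of `w_j`, the
composite of a path `v → w_j` with a path `w_j → v` is parallel to the trivial path, so its class is
`ρ(v)`. Hence each `ρ(v)`, and so `1 = ∑ ρ(v)`, lies in the trace ideal of `P`
(`exists_trace_skeletonModule`). A finitely generated projective module with full trace ideal is a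
generator, and `Hom(P, -)` is then an equivalence onto right `End P`-modules
(`isMoritaEquivalent_end_of_trace`). For basicness, let `e_j` be the projections of `P` onto its
summands. Then `e_j Sk e_j` consists of scalar multiples of `e_j`, and `e_j Sk e_i Sk e_j = 0` for
`i ≠ j`, since distinct components are not joined by paths in both directions. This forces a simple
module to be a line concentrated at a single `e_j` (`Skeleton.finrank_eq_one_of_isSimpleModule`). -/

/-! ### Projective generators and Morita equivalence -/

section Precomposition

variable {R : Type*} [Ring R] {P : Type*} [AddCommGroup P] [Module R P]

/-- The right action of `End P` on the homomorphisms `P → M` by precomposition. -/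
abbrev LinearMap.precompModule (M : Type*) [AddCommGroup M] [Module R M] :
    Module (Module.End R P)ᵐᵒᵖ (P →ₗ[R] M) where
  smul s f := f ∘ₗ s.unop
  one_smul _ := rfl
  mul_smul _ _ _ := rfl
  smul_zero _ := rfl
  smul_add _ _ _ := rfl
  add_smul s t f := LinearMap.comp_add s.unop t.unop f
  zero_smul f := LinearMap.comp_zero f

attribute [local instance] LinearMap.precompModule

theorem LinearMap.precomp_smul_apply {M : Type*} [AddCommGroup M] [Module R M]
    (s : (Module.End R P)ᵐᵒᵖ) (f : P →ₗ[R] M) (x : P) : (s • f) x = f (s.unop x) := rfl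

/-- The homomorphisms of right `End P`-modules from the dual of `P` to `N`. -/
def DualHom (R : Type*) [Ring R] (P : Type*) [AddCommGroup P] [Module R P]
    (N : Type*) [AddCommGroup N] [Module (Module.End R P)ᵐᵒᵖ N] : Type _ :=
  (P →ₗ[R] R) →ₗ[(Module.End R P)ᵐᵒᵖ] N

namespace DualHom

variable {N : Type*} [AddCommGroup N] [Module (Module.End R P)ᵐᵒᵖ N]

instance : AddCommGroup (DualHom R P N) :=
  inferInstanceAs (AddCommGroup ((P →ₗ[R] R) →ₗ[(Module.End R P)ᵐᵒᵖ] N))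

instance : FunLike (DualHom R P N) (P →ₗ[R] R) N :=
  inferInstanceAs (FunLike ((P →ₗ[R] R) →ₗ[(Module.End R P)ᵐᵒᵖ] N) _ _)

@[ext] theorem ext {f g : DualHom R P N} (h : ∀ φ, f φ = g φ) : f = g := LinearMap.ext h

theorem map_add_apply (f : DualHom R P N) (φ ψ : P →ₗ[R] R) : f (φ + ψ) = f φ + f ψ :=
  LinearMap.map_add (σ := RingHom.id (Module.End R P)ᵐᵒᵖ) (M₃ := N) f φ ψ

theorem map_zero_apply (f : DualHom R P N) : f 0 = 0 :=
  LinearMap.map_zero (σ := RingHom.id (Module.End R P)ᵐᵒᵖ) (M₃ := N) f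

theorem map_smul_apply (f : DualHom R P N) (s : (Module.End R P)ᵐᵒᵖ) (φ : P →ₗ[R] R) :
    f (s • φ) = s • f φ :=
  LinearMap.map_smul (R := (Module.End R P)ᵐᵒᵖ) (M₂ := N) f s φ

theorem sum_apply {ι : Type*} (s : Finset ι) (f : ι → DualHom R P N) (φ : P →ₗ[R] R) :
    (∑ i ∈ s, f i) φ = ∑ i ∈ s, f i φ :=
  LinearMap.sum_apply s (M₂ := N) (f : ι → ((P →ₗ[R] R) →ₗ[(Module.End R P)ᵐᵒᵖ] N)) φ

/-- `R` acts on `DualHom R P N` through its right action on the dual of `P`. -/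
instance : Module R (DualHom R P N) where
  smul r f :=
    { toFun := fun φ => f (φ.smulRight r)
      map_add' := fun φ ψ => by
        rw [← map_add_apply]
        congr 1
        ext x
        simp [add_mul]
      map_smul' := fun s φ => by
        rw [RingHom.id_apply, ← map_smul_apply]
        rfl }
  one_smul f := ext fun φ => congrArg f (by ext x; simp)
  mul_smul r r' f := ext fun φ => congrArg f (by ext x; simp [mul_assoc])
  smul_zero r := rfl
  smul_add r f g := rfl
  add_smul r r' f := ext fun φ =>
    (congrArg f (by ext x; simp [mul_add])).trans
      (map_add_apply f (φ.smulRight r) (φ.smulRight r'))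
  zero_smul f := ext fun φ => (congrArg f (by ext x; simp)).trans (map_zero_apply f)

theorem smul_apply (r : R) (f : DualHom R P N) (φ : P →ₗ[R] R) :
    (r • f) φ = f (φ.smulRight r) := rfl

/-- The homomorphism `p ↦ (φ ↦ n · (p ⊗ φ))` given by an element `n`. -/
def ofElem (n : N) : P →ₗ[R] DualHom R P N where
  toFun p :=
    { toFun := fun φ => MulOpposite.op (φ.smulRight p : Module.End R P) • n
      map_add' := fun φ ψ => by
        rw [← add_smul, ← MulOpposite.op_add]
        congr 2
        ext x
        simp [add_smul]
      map_smul' := fun s φ => by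
        rw [RingHom.id_apply, ← mul_smul]
        rfl }
  map_add' p q := ext fun φ => by
    change MulOpposite.op (φ.smulRight (p + q) : Module.End R P) • n =
      MulOpposite.op (φ.smulRight p : Module.End R P) • n +
        MulOpposite.op (φ.smulRight q : Module.End R P) • n
    rw [← add_smul, ← MulOpposite.op_add]
    congr 2
    ext x
    simp
  map_smul' r p := ext fun φ => by
    change MulOpposite.op (φ.smulRight (r • p) : Module.End R P) • n =
      MulOpposite.op ((φ.smulRight r).smulRight p : Module.End R P) • n
    congr 2
    ext x
    simp [mul_smul]

theorem ofElem_apply (n : N) (p : P) (φ : P →ₗ[R] R) :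
    ofElem n p φ = MulOpposite.op (φ.smulRight p : Module.End R P) • n := rfl

/-- For a module `P` with a finite dual basis, `N` is recovered as `Hom(P, DualHom R P N)`. -/
def homEquiv {ι : Type*} [Fintype ι] (p : ι → P) (φ : ι → P →ₗ[R] R)
    (h : ∀ x, ∑ i, φ i x • p i = x) :
    (P →ₗ[R] DualHom R P N) ≃ₗ[(Module.End R P)ᵐᵒᵖ] N :=
  LinearEquiv.symm
  { toFun := ofElem
    map_add' := fun n m => by
      ext x ψ
      exact smul_add _ n m
    map_smul' := fun s n => by
      ext x ψ
      rw [RingHom.id_apply, LinearMap.precomp_smul_apply, ofElem_apply, ofElem_apply, ← mul_smul]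
      congr 1
      apply MulOpposite.unop_injective
      ext y
      simp
    -- The identity of `P` is `∑ φ i ⊗ p i`, so evaluating `g` there recovers `n`.
    invFun := fun g => ∑ i, g (p i) (φ i)
    left_inv := fun n => by
      simp only [ofElem_apply]
      rw [← Finset.sum_smul, ← Finset.op_sum]
      convert one_smul (Module.End R P)ᵐᵒᵖ n
      apply MulOpposite.unop_injective
      ext x
      simp [h]
    right_inv := fun g => by
      ext x ψ
      rw [ofElem_apply, Finset.smul_sum]
      conv_rhs => rw [← h x, map_sum, sum_apply]
      refine Finset.sum_congr rfl fun i _ => ?_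
      rw [map_smul, smul_apply, ← map_smul_apply]
      congr 1
      ext y
      simp [LinearMap.precomp_smul_apply] }

end DualHom

/-- A surjection `R^n → P` splits: take the images of the standard basis and the coordinates of a
section. -/
theorem Module.Projective.exists_finite_dual_basis (R P : Type*) [Ring R] [AddCommGroup P]
    [Module R P] [Module.Finite R P] [Module.Projective R P] :
    ∃ (n : ℕ) (p : Fin n → P) (φ : Fin n → P →ₗ[R] R), ∀ x, ∑ i, φ i x • p i = x := by
  obtain ⟨n, f, hf⟩ := Module.Finite.exists_fin' R P
  obtain ⟨g, hg⟩ := Module.projective_lifting_property f LinearMap.id hf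
  refine ⟨n, fun i => f (Pi.single i 1), fun i => LinearMap.proj i ∘ₗ g, fun x => ?_⟩
  conv_rhs => rw [← LinearMap.id_apply (R := R) x, ← hg, LinearMap.comp_apply,
    pi_eq_sum_univ' (g x), map_sum]
  exact Finset.sum_congr rfl fun i _ => (map_smul f _ _).symm

variable {ι : Type*} [Fintype ι] {ψ : ι → P →ₗ[R] R} {q : ι → P}
  {M M' : Type*} [AddCommGroup M] [Module R M] [AddCommGroup M'] [Module R M']

/-- The hypothesis says that the trace ideal of `P` is all of `R`. It makes every element of every
module a sum of values of homomorphisms from `P`. -/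
theorem sum_smulRight_of_trace (h : ∑ i, ψ i (q i) = 1) (m : M) :
    ∑ i, (ψ i).smulRight m (q i) = m := by
  simp [← Finset.sum_smul, h]

/-- Fullness of `Hom(P, -)`. Writing `m` as a sum of values of maps from `P` leaves only one
candidate for `f m`, the map `F` below. -/
theorem LinearMap.exists_comp_eq_of_trace (h : ∑ i, ψ i (q i) = 1)
    (θ : (P →ₗ[R] M) →ₗ[(Module.End R P)ᵐᵒᵖ] (P →ₗ[R] M')) :
    ∃ f : M →ₗ[R] M', ∀ g, f ∘ₗ g = θ g := by
  let F : M →+ M' :=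
    { toFun := fun m => ∑ i, θ ((ψ i).smulRight m) (q i)
      map_zero' := by simp
      map_add' := fun m m' => by
        rw [← Finset.sum_add_distrib]
        refine Finset.sum_congr rfl fun i _ => ?_
        rw [← LinearMap.add_apply, ← map_add]
        congr 2
        ext x
        simp }
  have hF : ∀ (g : P →ₗ[R] M) (p : P), F (g p) = θ g p := fun g p => by
    change ∑ i, θ ((ψ i).smulRight (g p)) (q i) = θ g p
    -- The map `ψ i (-) • g p` factors through `g` by an endomorphism of `P`, which `θ` lets
    -- through.
    have h1 : ∀ i, (ψ i).smulRight (g p) =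
        MulOpposite.op ((ψ i).smulRight p : Module.End R P) • g := fun i => by
      ext x
      simp [LinearMap.precomp_smul_apply]
    simp_rw [h1, map_smul, LinearMap.precomp_smul_apply]
    rw [← map_sum]
    congr 1
    exact sum_smulRight_of_trace h p
  refine ⟨{ F with map_smul' := fun r m => ?_ }, fun g => LinearMap.ext fun p => hF g p⟩
  change F (r • m) = r • F m
  -- It suffices to check linearity on values of maps from `P`, where `F` is given by `hF`.
  conv_lhs => rw [← sum_smulRight_of_trace h m, Finset.smul_sum, map_sum]
  conv_rhs => rw [← sum_smulRight_of_trace h m, map_sum, Finset.smul_sum]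
  refine Finset.sum_congr rfl fun i _ => ?_
  rw [← map_smul, hF, hF, map_smul]

theorem LinearMap.ext_of_trace (h : ∑ i, ψ i (q i) = 1) {f f' : M →ₗ[R] M'}
    (hf : ∀ g : P →ₗ[R] M, f ∘ₗ g = f' ∘ₗ g) : f = f' := by
  ext m
  rw [← sum_smulRight_of_trace h m, map_sum, map_sum]
  exact Finset.sum_congr rfl fun i _ => LinearMap.congr_fun (hf _) _

theorem exists_surjective_of_trace (h : ∑ i, ψ i (q i) = 1) [Module.Finite R M] :
    ∃ (n : ℕ) (f : (Fin n → P) →ₗ[R] M), Function.Surjective f := by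
  obtain ⟨n, s, hs⟩ := Module.Finite.exists_fin (R := R) (M := M)
  -- One copy of `P` for each pair of a generator `s i` of `M` and an index of the trace relation.
  let e := (Fintype.equivFin (Fin n × ι)).symm
  let f : (Fin (Fintype.card (Fin n × ι)) → P) →ₗ[R] M :=
    LinearMap.lsum R (fun _ => P) ℕ fun k => (ψ (e k).2).smulRight (s (e k).1)
  refine ⟨_, f, LinearMap.range_eq_top.1 (eq_top_iff.2 ?_)⟩
  rw [← hs, Submodule.span_le]
  rintro _ ⟨i, rfl⟩
  rw [SetLike.mem_coe, ← sum_smulRight_of_trace h (s i)]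
  refine Submodule.sum_mem _ fun j _ => ⟨Pi.single (e.symm (i, j)) (q j), ?_⟩
  simp only [f]
  rw [LinearMap.lsum_piSingle]
  simp

end Precomposition

/-! ### Morita equivalence through `Hom(P, -)` -/

section Morita

universe w₁ w₂

open CategoryTheory
open scoped ModuleCat.Algebra

attribute [local instance] LinearMap.precompModule

/-- The functor `Hom(P, -)` from `R`-modules to right `End P`-modules. -/
def homFunctor (R : Type w₂) [Ring R] (P : Type w₂) [AddCommGroup P] [Module R P] :
    ModuleCat.{w₂} R ⥤ ModuleCat.{w₂} (Module.End R P)ᵐᵒᵖ where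
  obj M := ModuleCat.of _ (P →ₗ[R] M)
  map f := ModuleCat.ofHom
    { toFun := fun g => f.hom ∘ₗ g
      map_add' := fun g g' => LinearMap.comp_add g g' f.hom
      map_smul' := fun _ _ => rfl }

/-- The trace relation gives full faithfulness; a finite dual basis gives essential surjectivity,
with `DualHom R P N` as preimage of `N`. -/
theorem isMoritaEquivalent_end_of_trace (K : Type w₁) [CommRing K] {R : Type w₂} [Ring R]
    [Algebra K R] (P : Type w₂) [AddCommGroup P] [Module R P] [Module K P] [IsScalarTower K R P]
    [Module.Finite R P] [Module.Projective R P] {ι : Type*} [Fintype ι]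
    {ψ : ι → P →ₗ[R] R} {q : ι → P} (h : ∑ i, ψ i (q i) = 1) :
    IsMoritaEquivalent K R (Module.End R P)ᵐᵒᵖ := by
  have : (homFunctor R P).Faithful := ⟨fun {M M' f f'} hff => ModuleCat.hom_ext <|
    LinearMap.ext_of_trace h fun g => LinearMap.congr_fun (congrArg ModuleCat.Hom.hom hff) g⟩
  have : (homFunctor R P).Full := ⟨fun {M M'} θ => by
    obtain ⟨f, hf⟩ := LinearMap.exists_comp_eq_of_trace h θ.hom
    exact ⟨ModuleCat.ofHom f, ModuleCat.hom_ext <| LinearMap.ext hf⟩⟩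
  have : (homFunctor R P).EssSurj := ⟨fun N => by
    obtain ⟨n, p, φ, hp⟩ := Module.Projective.exists_finite_dual_basis R P
    exact ⟨ModuleCat.of R (DualHom R P N), ⟨(DualHom.homEquiv p φ hp).toModuleIso⟩⟩⟩
  have : (homFunctor R P).IsEquivalence := { }
  refine ⟨⟨⟨(homFunctor R P).asEquivalence, ⟨fun {M M'} f k => ?_⟩⟩⟩⟩
  refine ModuleCat.hom_ext <| LinearMap.ext fun (g : P →ₗ[R] M) => LinearMap.ext fun x => ?_
  -- Scalars act through `R` on the target module, but by precomposition on `Hom(P, -)`.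
  change algebraMap K R k • f.hom (g x) = f.hom (g (k • x))
  rw [← map_smul, ← map_smul, algebraMap_smul]

end Morita

/-! ### The commuting algebra -/

section CommutingAlgebra

variable {K : Type*} [Field K] {V : Type*} [Quiver V] [Fintype V]

variable (K) in
/-- The class of a path in the commuting algebra. -/
noncomputable def pathClass {a b : V} (p : Quiver.Path a b) : CommutingAlgebra K V :=
  commutingProj K V (PathAlgebra.of K ⟨a, b, p⟩)

theorem commutingProj_surjective : Function.Surjective (commutingProj K V) :=
  RingCon.mk'_surjective _

theorem commutingProj_smul (k : K) (x : PathAlgebra K V) :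
    commutingProj K V (k • x) = k • commutingProj K V x := rfl

theorem pathClass_nil (v : V) : pathClass K (Quiver.Path.nil : Quiver.Path v v) =
    vertexClass K v := rfl

theorem pathClass_mul {a b c : V} (p : Quiver.Path a b) (q : Quiver.Path b c) :
    pathClass K p * pathClass K q = pathClass K (p.comp q) := by
  rw [pathClass, pathClass, ← map_mul, PathAlgebra.comp_of, pathClass]

/-- The only place where the generators of the ideal `C` enter. -/
theorem pathClass_eq {a b : V} (p q : Quiver.Path a b) : pathClass K p = pathClass K q := by
  refine (RingCon.eq _).2 ?_
  have h : PathAlgebra.of K ⟨a, b, p⟩ - PathAlgebra.of K ⟨a, b, q⟩ ∈ commutingIdeal K V :=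
    TwoSidedIdeal.subset_span ⟨a, b, p, q, rfl⟩
  exact (TwoSidedIdeal.rel_iff _ _ _).2 h

theorem vertexClass_mul_pathClass {a b : V} (p : Quiver.Path a b) :
    vertexClass K a * pathClass K p = pathClass K p := by
  rw [← pathClass_nil, pathClass_mul, Quiver.Path.nil_comp]

theorem pathClass_mul_vertexClass {a b : V} (p : Quiver.Path a b) :
    pathClass K p * vertexClass K b = pathClass K p := by
  rw [← pathClass_nil, pathClass_mul, Quiver.Path.comp_nil]

theorem vertexClass_mul_self (v : V) : vertexClass K v * vertexClass K v = vertexClass K v := by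
  rw [← pathClass_nil, pathClass_mul, Quiver.Path.comp_nil]

theorem vertexClass_mul_pathClass_of_ne {a b v : V} (h : v ≠ a) (p : Quiver.Path a b) :
    vertexClass K v * pathClass K p = 0 := by
  rw [vertexClass, pathClass, ← map_mul, PathAlgebra.vertex, PathAlgebra.of_mul_of_ne K _ _ h,
    map_zero]

theorem pathClass_mul_vertexClass_of_ne {a b v : V} (h : b ≠ v) (p : Quiver.Path a b) :
    pathClass K p * vertexClass K v = 0 := by
  rw [vertexClass, pathClass, ← map_mul, PathAlgebra.vertex, PathAlgebra.of_mul_of_ne K _ _ h,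
    map_zero]

theorem sum_vertexClass : ∑ v : V, vertexClass K v = 1 := by
  simp only [vertexClass]
  rw [← map_sum, ← PathAlgebra.one_def, map_one]

theorem PathAlgebra.of_induction {C : PathAlgebra K V → Prop} (x : PathAlgebra K V)
    (zero : C 0) (add : ∀ x y, C x → C y → C (x + y)) (smul : ∀ (k : K) x, C x → C (k • x))
    (of : ∀ p, C (PathAlgebra.of K p)) : C x := by
  refine Finsupp.induction_linear (motive := C) x zero (fun x y => add x y) fun p k => ?_
  have h : (Finsupp.single p k : QuiverPath V →₀ K) = k • (Finsupp.single p 1) := by simp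
  rw [h]
  exact smul k _ (of p)

theorem CommutingAlgebra.induction {C : CommutingAlgebra K V → Prop} (x : CommutingAlgebra K V)
    (zero : C 0) (add : ∀ x y, C x → C y → C (x + y)) (smul : ∀ (k : K) x, C x → C (k • x))
    (pathClass : ∀ (a b : V) (p : Quiver.Path a b), C (pathClass K p)) : C x := by
  obtain ⟨x, rfl⟩ := commutingProj_surjective x
  refine PathAlgebra.of_induction (C := fun x => C (commutingProj K V x)) x ?_ ?_ ?_ ?_
  · rwa [map_zero]
  · intro x y hx hy
    rw [map_add]
    exact add _ _ hx hy
  · intro k x hx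
    rw [commutingProj_smul]
    exact smul k _ hx
  · exact fun p => pathClass _ _ p.path

/-- One path class for each ordered pair of vertices suffices to span. -/
instance CommutingAlgebra.finite : Module.Finite K (CommutingAlgebra K V) := by
  classical
  let s : V × V → CommutingAlgebra K V := fun x =>
    if h : Nonempty (Quiver.Path x.1 x.2) then pathClass K h.some else 0
  refine ⟨⟨(Set.finite_range s).toFinset, eq_top_iff.2 fun x _ => ?_⟩⟩
  rw [Set.Finite.coe_toFinset]
  refine CommutingAlgebra.induction x (Submodule.zero_mem _) (fun _ _ => Submodule.add_mem _)
    (fun k _ => Submodule.smul_mem _ k) fun a b p => Submodule.subset_span ⟨(a, b), ?_⟩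
  have h : Nonempty (Quiver.Path a b) := ⟨p⟩
  simp only [s, dif_pos h]
  exact pathClass_eq _ _

theorem vertexClass_mul_mul_of_isEmpty {a b : V} (h : IsEmpty (Quiver.Path a b))
    (x : CommutingAlgebra K V) : vertexClass K a * x * vertexClass K b = 0 := by
  refine CommutingAlgebra.induction
    (C := fun x => vertexClass K a * x * vertexClass K b = 0) x (by simp) (fun x y hx hy => by
    rw [mul_add, add_mul, hx, hy, add_zero]) (fun k x hx => by
    rw [mul_smul_comm, smul_mul_assoc, hx, smul_zero]) fun c d p => ?_
  by_cases hc : a = c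
  · subst hc
    by_cases hd : d = b
    · subst hd
      exact h.elim p
    · rw [mul_assoc, pathClass_mul_vertexClass_of_ne hd, mul_zero]
  · rw [vertexClass_mul_pathClass_of_ne hc, zero_mul]

/-- Every closed path at `v` is parallel to the trivial one. -/
theorem exists_vertexClass_mul_mul_eq_smul (v : V) (x : CommutingAlgebra K V) :
    ∃ k : K, vertexClass K v * x * vertexClass K v = k • vertexClass K v := by
  refine CommutingAlgebra.induction
    (C := fun x => ∃ k : K, vertexClass K v * x * vertexClass K v = k • vertexClass K v)
    x ⟨0, by simp⟩ ?_ ?_ fun c d p => ?_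
  · rintro x y ⟨k, hk⟩ ⟨l, hl⟩
    exact ⟨k + l, by rw [mul_add, add_mul, hk, hl, add_smul]⟩
  · rintro l x ⟨k, hk⟩
    exact ⟨l * k, by rw [mul_smul_comm, smul_mul_assoc, hk, mul_smul]⟩
  · by_cases hc : v = c
    · subst hc
      by_cases hd : d = v
      · subst hd
        exact ⟨1, by rw [vertexClass_mul_pathClass, pathClass_mul_vertexClass, one_smul,
          ← pathClass_nil]; exact pathClass_eq _ _⟩
      · exact ⟨0, by rw [mul_assoc, pathClass_mul_vertexClass_of_ne hd, mul_zero, zero_smul]⟩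
    · exact ⟨0, by rw [vertexClass_mul_pathClass_of_ne hc, zero_mul, zero_smul]⟩

end CommutingAlgebra

/-! ### The right modules `ρ(v) KQ/C` and their homomorphisms -/

/-- A ring is isomorphic, as a right module over itself, to its opposite ring. -/
def MulOpposite.opSelfLinearEquiv (A : Type*) [Ring A] : A ≃ₗ[Aᵐᵒᵖ] Aᵐᵒᵖ :=
  { MulOpposite.opAddEquiv with map_smul' := fun _ _ => rfl }

instance (A : Type*) [Ring A] : Module.Finite Aᵐᵒᵖ A :=
  Module.Finite.equiv (MulOpposite.opSelfLinearEquiv A).symm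

instance (A : Type*) [Ring A] : Module.Projective Aᵐᵒᵖ A :=
  Module.Projective.of_equiv (MulOpposite.opSelfLinearEquiv A).symm

section VertexModule

variable {K : Type*} [Field K] {V : Type*} [Quiver V] [Fintype V]

theorem mem_vertexRightIdeal_iff {v : V} {x : CommutingAlgebra K V} :
    x ∈ vertexRightIdeal K v ↔ vertexClass K v * x = x := by
  rw [vertexRightIdeal, Submodule.mem_span_singleton]
  constructor
  · rintro ⟨a, rfl⟩
    rw [MulOpposite.smul_eq_mul_unop, ← mul_assoc, vertexClass_mul_self]
  · exact fun h => ⟨MulOpposite.op x, h⟩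

namespace VertexModule

variable (K) in
/-- The inclusion of `ρ(v) (K Q / C)` into `K Q / C`. -/
noncomputable def incl (v : V) :
    VertexModule K v →ₗ[(CommutingAlgebra K V)ᵐᵒᵖ] CommutingAlgebra K V :=
  (vertexRightIdeal K v).subtype

theorem incl_injective (v : V) : Function.Injective (incl K v) := Subtype.val_injective

theorem vertexClass_mul_incl {v : V} (x : VertexModule K v) :
    vertexClass K v * incl K v x = incl K v x :=
  mem_vertexRightIdeal_iff.1 x.2

/-- An element fixed by left multiplication by `ρ(v)` as an element of `ρ(v) (K Q / C)`. -/
def mk {v : V} (x : CommutingAlgebra K V) (h : vertexClass K v * x = x) : VertexModule K v :=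
  ⟨x, mem_vertexRightIdeal_iff.2 h⟩

theorem incl_mk {v : V} (x : CommutingAlgebra K V) (h : vertexClass K v * x = x) :
    incl K v (mk x h) = x := rfl

variable (K) in
/-- Left multiplication by `ρ(v)`. -/
noncomputable def proj (v : V) :
    CommutingAlgebra K V →ₗ[(CommutingAlgebra K V)ᵐᵒᵖ] VertexModule K v where
  toFun x := mk (vertexClass K v * x) (by rw [← mul_assoc, vertexClass_mul_self])
  map_add' x y := Subtype.ext (mul_add _ x y)
  map_smul' a x := Subtype.ext (mul_assoc _ x a.unop).symm

theorem proj_incl {v : V} (x : VertexModule K v) : proj K v (incl K v x) = x :=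
  incl_injective v (vertexClass_mul_incl x)

instance (v : V) : Module.Finite (CommutingAlgebra K V)ᵐᵒᵖ (VertexModule K v) :=
  Module.Finite.of_surjective (proj K v) fun x => ⟨_, proj_incl x⟩

instance (v : V) : Module.Projective (CommutingAlgebra K V)ᵐᵒᵖ (VertexModule K v) :=
  Module.Projective.of_split (incl K v) (proj K v) (LinearMap.ext proj_incl)

variable (K) in
/-- The vertex `ρ(v)` as the generator of `ρ(v) (K Q / C)`. -/
noncomputable def gen (v : V) : VertexModule K v := mk (vertexClass K v) (vertexClass_mul_self v)

theorem incl_gen (v : V) : incl K v (gen K v) = vertexClass K v := rfl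

theorem op_smul_gen {v : V} (x : VertexModule K v) :
    MulOpposite.op (incl K v x) • gen K v = x :=
  incl_injective v (vertexClass_mul_incl x)

theorem incl_smul {v : V} (k : K) (x : VertexModule K v) :
    incl K v (k • x) = k • incl K v x := rfl

theorem hom_ext {v : V} {M : Type*} [AddCommGroup M] [Module (CommutingAlgebra K V)ᵐᵒᵖ M]
    {f g : VertexModule K v →ₗ[(CommutingAlgebra K V)ᵐᵒᵖ] M} (h : f (gen K v) = g (gen K v)) :
    f = g := by
  ext x
  rw [← op_smul_gen x, map_smul, map_smul, h]

/-- The generator is fixed by `ρ(b)` on the right, hence so is its image. Thus homomorphisms are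
controlled by `ρ(a) A ρ(b)`. -/
theorem incl_apply_gen {a b : V}
    (f : VertexModule K b →ₗ[(CommutingAlgebra K V)ᵐᵒᵖ] VertexModule K a) :
    vertexClass K a * incl K a (f (gen K b)) * vertexClass K b = incl K a (f (gen K b)) := by
  rw [vertexClass_mul_incl]
  conv_rhs => rw [← op_smul_gen (gen K b), map_smul, map_smul]
  rfl

theorem hom_eq_zero_of_isEmpty {a b : V} (h : IsEmpty (Quiver.Path a b))
    (f : VertexModule K b →ₗ[(CommutingAlgebra K V)ᵐᵒᵖ] VertexModule K a) : f = 0 := by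
  refine hom_ext (incl_injective a ?_)
  rw [← incl_apply_gen, vertexClass_mul_mul_of_isEmpty h, LinearMap.zero_apply, map_zero]

theorem exists_apply_eq_smul {v : V}
    (f : VertexModule K v →ₗ[(CommutingAlgebra K V)ᵐᵒᵖ] VertexModule K v) :
    ∃ k : K, ∀ x, f x = k • x := by
  obtain ⟨k, hk⟩ := exists_vertexClass_mul_mul_eq_smul v (incl K v (f (gen K v)))
  refine ⟨k, fun x => ?_⟩
  rw [incl_apply_gen] at hk
  have h : f (gen K v) = k • gen K v := incl_injective v (by rw [hk, incl_smul, incl_gen])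
  rw [← op_smul_gen x, map_smul, h, smul_comm]

end VertexModule

end VertexModule

/-! ### The skeleton and its simple modules -/

section Skeleton

variable {K : Type*} [Field K] {V : Type*} [Quiver V] [Fintype V]

instance : Finite (Quiver.StronglyConnectedComponent V) :=
  Quotient.finite (Quiver.stronglyConnectedSetoid V)

variable {w : Quiver.StronglyConnectedComponent V → V}

theorem exists_trace_skeletonModule (hw : ∀ j, Quiver.StronglyConnectedComponent.mk (w j) = j) :
    ∃ (ψ : V → skeletonModule K w →ₗ[(CommutingAlgebra K V)ᵐᵒᵖ] (CommutingAlgebra K V)ᵐᵒᵖ)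
      (q : V → skeletonModule K w), ∑ v, ψ v (q v) = 1 := by
  classical
  have hp : ∀ v : V, Nonempty (Quiver.Path v (w v)) ∧ Nonempty (Quiver.Path (w v) v) := fun v =>
    (Quiver.StronglyConnectedComponent.eq v _).1 (hw v).symm
  let e : CommutingAlgebra K V →ₗ[(CommutingAlgebra K V)ᵐᵒᵖ] (CommutingAlgebra K V)ᵐᵒᵖ :=
    (MulOpposite.opSelfLinearEquiv (CommutingAlgebra K V)).toLinearMap
  let l : CommutingAlgebra K V →
      CommutingAlgebra K V →ₗ[(CommutingAlgebra K V)ᵐᵒᵖ] CommutingAlgebra K V := fun a =>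
    { toFun := fun x => a * x
      map_add' := mul_add a
      map_smul' := fun b x => (mul_assoc a x b.unop).symm }
  -- Here `w v` is the representative of the component of `v`. The functional multiplies by a path
  -- `v → w v`, and the element is a path `w v → v`.
  refine ⟨fun v => e ∘ₗ l (pathClass K (hp v).1.some) ∘ₗ VertexModule.incl K (w v) ∘ₗ
      DirectSum.component _ _ (fun j => VertexModule K (w j)) v,
    fun v => DirectSum.lof (CommutingAlgebra K V)ᵐᵒᵖ _ (fun j => VertexModule K (w j)) v
      (VertexModule.mk (pathClass K (hp v).2.some) (vertexClass_mul_pathClass _)), ?_⟩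
  have h : ∀ v : V, pathClass K (hp v).1.some * pathClass K (hp v).2.some = vertexClass K v :=
    fun v => by rw [pathClass_mul, ← pathClass_nil]; exact pathClass_eq _ _
  simp only [LinearMap.comp_apply, DirectSum.component.lof_self, VertexModule.incl_mk]
  change ∑ v, MulOpposite.op (pathClass K (hp v).1.some * pathClass K (hp v).2.some) = 1
  simp only [h]
  rw [← Finset.op_sum, sum_vertexClass, MulOpposite.op_one]

instance : Module.Finite (CommutingAlgebra K V)ᵐᵒᵖ (skeletonModule K w) :=
  have := Fintype.ofFinite (Quiver.StronglyConnectedComponent V)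
  inferInstance

instance : Module.Projective (CommutingAlgebra K V)ᵐᵒᵖ (skeletonModule K w) :=
  inferInstance

/-- The skeleton embeds in `End_K(P)`, and `P` is finite over a finite-dimensional algebra. -/
instance Skeleton.finite : Module.Finite K (Skeleton K w) := by
  have : Module.Finite K (CommutingAlgebra K V)ᵐᵒᵖ :=
    Module.Finite.equiv (MulOpposite.opLinearEquiv K)
  have : Module.Finite K (skeletonModule K w) := Module.Finite.trans (CommutingAlgebra K V)ᵐᵒᵖ _
  let f : Skeleton K w →ₗ[K] Module.End K (skeletonModule K w) :=
    { toFun := fun f => f.restrictScalars K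
      map_add' := fun _ _ => rfl
      map_smul' := fun _ _ => rfl }
  exact Module.Finite.of_injective f (LinearMap.restrictScalars_injective K)

open Classical in
variable (K w) in
/-- The projection of the module `P` onto its summand at `j`. -/
noncomputable def Skeleton.idem (j : Quiver.StronglyConnectedComponent V) : Skeleton K w :=
  DirectSum.lof _ _ _ j ∘ₗ DirectSum.component _ _ _ j

theorem Skeleton.idem_mul_self (j : Quiver.StronglyConnectedComponent V) :
    idem K w j * idem K w j = idem K w j := by
  classical
  refine LinearMap.ext fun x => ?_
  simp [idem, DirectSum.component.lof_self]

theorem Skeleton.sum_idem [Fintype (Quiver.StronglyConnectedComponent V)] :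
    ∑ j, idem K w j = 1 := by
  classical
  refine LinearMap.ext fun x => ?_
  rw [LinearMap.sum_apply]
  exact DirectSum.sum_univ_of x

theorem Skeleton.idem_mul_mul_of_isEmpty {i j : Quiver.StronglyConnectedComponent V}
    (h : IsEmpty (Quiver.Path (w j) (w i))) (b : Skeleton K w) :
    idem K w j * b * idem K w i = 0 := by
  classical
  have h0 := VertexModule.hom_eq_zero_of_isEmpty h
    (DirectSum.component _ _ (fun j => VertexModule K (w j)) j ∘ₗ b ∘ₗ
    DirectSum.lof (CommutingAlgebra K V)ᵐᵒᵖ _ (fun j => VertexModule K (w j)) i)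
  refine LinearMap.ext fun x => ?_
  have h1 := LinearMap.congr_fun h0
    (DirectSum.component (CommutingAlgebra K V)ᵐᵒᵖ _ (fun j => VertexModule K (w j)) i x)
  simp only [LinearMap.comp_apply, LinearMap.zero_apply] at h1
  simp [idem, h1]

theorem Skeleton.exists_idem_mul_mul_eq_smul (j : Quiver.StronglyConnectedComponent V)
    (b : Skeleton K w) : ∃ k : K, idem K w j * b * idem K w j = k • idem K w j := by
  classical
  obtain ⟨k, hk⟩ := VertexModule.exists_apply_eq_smul
    (DirectSum.component (CommutingAlgebra K V)ᵐᵒᵖ _ (fun j => VertexModule K (w j)) j ∘ₗ b ∘ₗ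
    DirectSum.lof (CommutingAlgebra K V)ᵐᵒᵖ _ (fun j => VertexModule K (w j)) j)
  refine ⟨k, LinearMap.ext fun x => ?_⟩
  have h1 := hk
    (DirectSum.component (CommutingAlgebra K V)ᵐᵒᵖ _ (fun j => VertexModule K (w j)) j x)
  simp only [LinearMap.comp_apply] at h1
  simp only [idem, Module.End.mul_apply, LinearMap.comp_apply, LinearMap.smul_apply, h1]
  rw [DirectSum.lof_eq_of, DirectSum.of_smul]
  rfl

/-- Were neither factor forced to vanish, paths in both directions would identify the components `i`
and `j`. -/
theorem Skeleton.idem_mul_mul_mul_mul_of_ne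
    (hw : ∀ j, Quiver.StronglyConnectedComponent.mk (w j) = j)
    {i j : Quiver.StronglyConnectedComponent V} (h : i ≠ j) (b c : Skeleton K w) :
    idem K w j * b * idem K w i * (c * idem K w j) = 0 := by
  rcases isEmpty_or_nonempty (Quiver.Path (w j) (w i)) with h1 | h1
  · rw [idem_mul_mul_of_isEmpty h1, zero_mul]
  rcases isEmpty_or_nonempty (Quiver.Path (w i) (w j)) with h2 | h2
  · rw [mul_assoc, ← mul_assoc (idem K w i), idem_mul_mul_of_isEmpty h2, mul_zero]
  · refine absurd ?_ h
    rw [← hw i, ← hw j]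
    exact (Quiver.StronglyConnectedComponent.eq _ _).2 ⟨h2, h1⟩

theorem Skeleton.finrank_eq_one_of_isSimpleModule
    (hw : ∀ j, Quiver.StronglyConnectedComponent.mk (w j) = j)
    (S : Type*) [AddCommGroup S] [Module K S] [Module (Skeleton K w)ᵐᵒᵖ S]
    [IsScalarTower K (Skeleton K w)ᵐᵒᵖ S] [IsSimpleModule (Skeleton K w)ᵐᵒᵖ S] :
    Module.finrank K S = 1 := by
  have := Fintype.ofFinite (Quiver.StronglyConnectedComponent V)
  have := IsSimpleModule.nontrivial (Skeleton K w)ᵐᵒᵖ S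
  have hsum : ∀ x : S, ∑ j, MulOpposite.op (idem K w j) • x = x := fun x => by
    rw [← Finset.sum_smul, ← Finset.op_sum, sum_idem, MulOpposite.op_one, one_smul]
  obtain ⟨x, hx⟩ := exists_ne (0 : S)
  obtain ⟨j, -, hj⟩ := Finset.exists_ne_zero_of_sum_ne_zero ((hsum x).trans_ne hx)
  -- As `x` is the sum of its components `x e_j`, some `y = x e_j` is nonzero; it will span `S` over
  -- `K`.
  set y := MulOpposite.op (idem K w j) • x with hy
  have hyj : MulOpposite.op (idem K w j) • y = y := by
    rw [hy, ← mul_smul, ← MulOpposite.op_mul, idem_mul_self]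
  refine (finrank_eq_one_iff_of_nonzero' y hj).2 fun z => ?_
  obtain ⟨b, rfl⟩ := IsSimpleModule.toSpanSingleton_surjective (Skeleton K w)ᵐᵒᵖ hj z
  induction b using MulOpposite.rec' with | _ b => ?_
  obtain ⟨k, hk⟩ := exists_idem_mul_mul_eq_smul j b
  refine ⟨k, ?_⟩
  rw [LinearMap.toSpanSingleton_apply, ← hsum (MulOpposite.op b • y),
    Finset.sum_eq_single_of_mem j (Finset.mem_univ j)]
  · conv_rhs => rw [← hyj]
    rw [← mul_smul, ← mul_smul, ← MulOpposite.op_mul, ← MulOpposite.op_mul, ← mul_assoc, hk,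
      MulOpposite.op_smul, smul_assoc, hyj]
  -- If `y b e_i ≠ 0`, it generates the simple module `S`, so `y = y b e_i c` for some `c`; then `y
  -- = y e_j b e_i c e_j = 0`, a contradiction.
  · intro i _ hi
    by_contra hz
    obtain ⟨c, hc⟩ := IsSimpleModule.toSpanSingleton_surjective (Skeleton K w)ᵐᵒᵖ hz y
    induction c using MulOpposite.rec' with | _ c => ?_
    rw [LinearMap.toSpanSingleton_apply] at hc
    have h0 := idem_mul_mul_mul_mul_of_ne hw hi b c
    refine hj ?_
    conv_lhs => rw [← hyj, ← hc, ← hyj]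
    simp only [← mul_smul, ← MulOpposite.op_mul]
    simp only [← mul_assoc] at h0 ⊢
    rw [h0, MulOpposite.op_zero, zero_smul]

end Skeleton

theorem theorem5p2 (K : Type k) [Field K] (V : Type u) [Quiver.{v} V] [Fintype V]
    (w : Quiver.StronglyConnectedComponent V → V)
    (hw : ∀ j, Quiver.StronglyConnectedComponent.mk (w j) = j) :
    IsRightProjectiveGenerator.{x} (CommutingAlgebra K V) (skeletonModule K w) ∧
    IsBasicAlgebra.{x} K (Skeleton K w) ∧
    -- the categories of right modules over the two algebras are `K`-linearly equivalent
    IsMoritaEquivalent K (CommutingAlgebra K V)ᵐᵒᵖ (Skeleton K w)ᵐᵒᵖ := by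

  obtain ⟨ψ, q, h⟩ := exists_trace_skeletonModule (K := K) hw
  exact ⟨⟨inferInstance, inferInstance, fun M _ _ _ => exists_surjective_of_trace h⟩,
    ⟨inferInstance, fun S _ _ _ _ _ => Skeleton.finrank_eq_one_of_isSimpleModule hw S⟩,
    isMoritaEquivalent_end_of_trace K (skeletonModule K w) h⟩
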